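/- Let $(q_n)_{n\ge 0}$ and $(a_{n,i})_{n\ge 0,\ 0\le i<q_n}$ be nonnegative integers, let $w_0=0$ and $w_{n+1}=w_n1^{a_{n,0}}w_n1^{a_{n,1}}\cdots w_n1^{a_{n,q_n-1}}w_n$ for $n\ge 0$, and let $X_{\mathcal W}\subseteq\{0,1\}^{\mathbb Z}$ be the set of two-sided sequences each of whose finite factors is a factor of some $w_n$, with the shift $S$. Assume that the Ferenczi subshift $(X_{\mathcal W},S)$ is minimal (in particular nonempty) and aperiodic (it has no periodic points). A continuous eigenfunction with eigenvalue $\lambda\in\mathbb C$ is a continuous $f:X_{\mathcal W}\to\mathbb C$, $f\ne 0$, with $f\circ S=\lambda f$. Then: 1. $(X_{\mathcal W},S)$ has no irrational continuous eigenvalue: if $\alpha\in\mathbb R$ is irrational, then $\exp(2\pi i\alpha)$ is not a continuous eigenvalue. 2. For coprime integers $p$ and $r\ge 1$, the number $\exp(2\pi i p/r)$ is a continuous eigenvalue of $(X_{\mathcal W},S)$ if and only if there is $n\ge 0$ such that $r$ divides $|w_n|+a_{m,i}$ for all $m\ge n$ and all $0\le i<q_m$. 3. $(X_{\mathcal W},S)$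 is topologically weakly mixing (i.e. every continuous eigenfunction is constant) if and only if for every integer $r>1$ and every $n\ge 0$ there are $m\ge n$ and $0\le i<q_m$ such that $r$ does not divide $|w_n|+a_{m,i}$. 4. There is a largest integer $r_{\max}\ge 1$ such that the cyclic system $(\mathbb Z/r_{\max}\mathbb Z,\,+1)$ is a topological factor of $(X_{\mathcal W},S)$, and this factor is the maximal equicontinuous factor of $(X_{\mathcal W},S)$: there is a factor map $\pi:X_{\mathcal W}\to\mathbb Z/r_{\max}\mathbb Z$ such that every factor map from $(X_{\mathcal W},S)$ onto an equicontinuous system (a homeomorphism of a compact metric space whose iterates are equicontinuous) is $\psi\circ\pi$ for a unique factor map $\psi$. -/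

import Mathlib

open Topology

universe u

namespace Ferenczi

section Systems

variable {X : Type*} [TopologicalSpace X] {Y : Type*} [TopologicalSpace Y]

/-- The system `(X, T)` is minimal: `X` is nonempty and every two-sided orbit is dense. -/
def IsMinimalSystem (T : X ≃ₜ X) : Prop :=
  Nonempty X ∧ ∀ x : X, Dense (Set.range fun n : ℤ => (T ^ n) x)

/-- The system `(X, T)` is aperiodic: it has no periodic point. -/
def IsAperiodicSystem (T : X ≃ₜ X) : Prop :=
  ∀ (x : X) (n : ℕ), 0 < n → T^[n] x ≠ x

/-- `f` is a continuous eigenfunction of `(X, T)` with eigenvalue `c`. -/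
def IsContinuousEigenfunction (T : X ≃ₜ X) (c : ℂ) (f : X → ℂ) : Prop :=
  Continuous f ∧ f ≠ 0 ∧ ∀ x, f (T x) = c * f x

/-- `c` is a continuous eigenvalue of `(X, T)`. -/
def IsContinuousEigenvalue (T : X ≃ₜ X) (c : ℂ) : Prop :=
  ∃ f : X → ℂ, IsContinuousEigenfunction T c f

/-- `(X, T)` is topologically weakly mixing: it has no nonconstant continuous eigenfunction. -/
def IsTopologicallyWeaklyMixing (T : X ≃ₜ X) : Prop :=
  ∀ (c : ℂ) (f : X → ℂ), IsContinuousEigenfunction T c f → ∀ x y, f x = f y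

/-- `φ` is a factor map from `(X, T)` onto `(Y, R)`. -/
def IsFactorMap (T : X ≃ₜ X) (R : Y ≃ₜ Y) (φ : X → Y) : Prop :=
  Continuous φ ∧ Function.Surjective φ ∧ ∀ x, φ (T x) = R (φ x)

/-- `(Y, R)` is a topological factor of `(X, T)`. -/
def IsTopologicalFactor (T : X ≃ₜ X) (R : Y ≃ₜ Y) : Prop :=
  ∃ φ : X → Y, IsFactorMap T R φ

/-- Equicontinuity of the iterates of `T`, stated through neighbourhoods of the diagonal.
On a compact metric space this is the usual condition with `ε` and `δ`
(`isEquicontinuousSystem_iff`), whatever the compatible metric. -/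
def IsEquicontinuousSystem (T : X ≃ₜ X) : Prop :=
  ∀ U ∈ 𝓝ˢ (Set.diagonal X), ∃ V ∈ 𝓝ˢ (Set.diagonal X),
    ∀ z ∈ V, ∀ n : ℕ, (T^[n] z.1, T^[n] z.2) ∈ U

theorem isEquicontinuousSystem_iff {Z : Type*} [MetricSpace Z] [CompactSpace Z] (T : Z ≃ₜ Z) :
    IsEquicontinuousSystem T ↔
      ∀ ε > 0, ∃ δ > 0, ∀ x y : Z, dist x y < δ → ∀ n : ℕ, dist (T^[n] x) (T^[n] y) < ε := by
  unfold IsEquicontinuousSystem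
  rw [nhdsSet_diagonal_eq_uniformity]
  constructor
  · intro h ε hε
    obtain ⟨V, hV, hVU⟩ := h _ (Metric.dist_mem_uniformity hε)
    obtain ⟨δ, hδ, hδV⟩ := Metric.mem_uniformity_dist.1 hV
    exact ⟨δ, hδ, fun x y hxy n => hVU (x, y) (hδV hxy) n⟩
  · intro h U hU
    obtain ⟨ε, hε, hεU⟩ := Metric.mem_uniformity_dist.1 hU
    obtain ⟨δ, hδ, hδε⟩ := h ε hε
    exact ⟨_, Metric.dist_mem_uniformity hδ, fun z hz n => hεU (hδε z.1 z.2 hz n)⟩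

/-- `(Y, R)` is the maximal equicontinuous factor of `(X, T)`: it is an equicontinuous factor,
through some factor map `π`, and every factor map from `(X, T)` onto an equicontinuous compact
metric system factors uniquely through `π`. -/
def IsMaximalEquicontinuousFactor (T : X ≃ₜ X) (R : Y ≃ₜ Y) : Prop :=
  IsEquicontinuousSystem R ∧
    ∃ π : X → Y, IsFactorMap T R π ∧
      ∀ (Z : Type u) [MetricSpace Z] [CompactSpace Z] (P : Z ≃ₜ Z) (φ : X → Z),
        IsEquicontinuousSystem P → IsFactorMap T P φ →
          ∃! ψ : Y → Z, IsFactorMap R P ψ ∧ ψ ∘ π = φ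

end Systems

/-- The cyclic system `(ℤ/qℤ, +1)`, with the discrete topology. -/
def cyclicSystem (q : ℕ) : ZMod q ≃ₜ ZMod q := Homeomorph.addRight 1

/-- The shift homeomorphism of `A^ℤ`, where `(shift A x) n = x (n + 1)`. -/
def shift (A : Type*) [TopologicalSpace A] : (ℤ → A) ≃ₜ (ℤ → A) where
  toFun x n := x (n + 1)
  invFun x n := x (n - 1)
  left_inv x := by ext n; simp
  right_inv x := by ext n; simp
  continuous_toFun := by fun_prop
  continuous_invFun := by fun_prop

/-- The word `x_k x_{k+1} ⋯ x_{k+l-1}`. -/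
def factor {A : Type*} (x : ℤ → A) (k : ℤ) (l : ℕ) : List A :=
  List.ofFn fun i : Fin l => x (k + (i : ℕ))

/-- The generating words for the cutting parameters `q n` and the spacers `a n i`, `i < q n`:
`w 0 = 0` and `w (n+1) = w n 1^(a n 0) w n 1^(a n 1) ⋯ w n 1^(a n (q n - 1)) w n`.
The values `a n i` with `q n ≤ i` are not used. -/
def genWord (q : ℕ → ℕ) (a : ℕ → ℕ → ℕ) : ℕ → List (Fin 2)
  | 0 => [0]
  | n + 1 =>
    ((List.range (q n)).flatMap fun i => genWord q a n ++ List.replicate (a n i) 1) ++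
      genWord q a n

/-- The set `X_W` of all two-sided sequences each of whose factors is a factor of some `w n`. -/
def ferencziSet (q : ℕ → ℕ) (a : ℕ → ℕ → ℕ) : Set (ℤ → Fin 2) :=
  {x | ∀ (k : ℤ) (l : ℕ), ∃ n, factor x k l <:+: genWord q a n}

theorem factor_shift {A : Type*} [TopologicalSpace A] (x : ℤ → A) (k : ℤ) (l : ℕ) :
    factor (shift A x) k l = factor x (k + 1) l := by
  change List.ofFn (fun i : Fin l => x (k + (i : ℕ) + 1)) = _
  simp only [factor, add_right_comm]

theorem mem_ferencziSet_iff_shift (q : ℕ → ℕ) (a : ℕ → ℕ → ℕ) (x : ℤ → Fin 2) :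
    x ∈ ferencziSet q a ↔ shift (Fin 2) x ∈ ferencziSet q a := by
  simp only [ferencziSet, Set.mem_ofPred_eq, factor_shift]
  exact ⟨fun h k l => h (k + 1) l, fun h k l => by simpa using h (k - 1) l⟩

/-- The shift map of the Ferenczi subshift `X_W`. -/
def ferencziShift (q : ℕ → ℕ) (a : ℕ → ℕ → ℕ) : ferencziSet q a ≃ₜ ferencziSet q a :=
  (shift (Fin 2)).subtype (mem_ferencziSet_iff_shift q a)

end Ferenczi

/-! Every eigenvalue question reduces to return times. For each `m ≥ n` and `i < q m` the word `w n
1^(a m i) w n` occurs in some point of `X_W`. Once `w n` is long, a continuous function nearly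
returns to its value after `|w n| + a m i` steps. For an eigenvalue `c`, or an equicontinuous factor
map, this makes `c ^ N`, or the `N`-th iterate on the factor, close to the identity for all these
times `N`. Aperiodicity makes the spacers bounded, yet two different ones occur beyond every level.
Subtracting two return times of the same level `n` gives almost-periods in a fixed finite set, hence
an exact period. The least exact period must divide all late return times (`exists_period_dvd`). So
eigenvalues are roots of unity and equicontinuous factors are periodic, with moduli controlled by
the return times. Conversely, let `r` divide all `|w n| + a m i` from level `n` on. A word `w n 1^x
w n 1^y w n` with `x ≠ y` can only occur aligned with the decomposition into copies of `w n`
(`dvd_of_interlace_eq`). Its positions in a point therefore agree modulo `r`, which defines a factor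
map onto `ℤ/rℤ` (`isTopologicalFactor_cyclicSystem`). The admissible `r` are bounded and closed
under lcm, so they all divide a largest one, which gives the maximal equicontinuous factor. -/

namespace Ferenczi

/-! ### Combinatorics of the generating words and their gap sequences. -/

section Words

variable {α β : Type*}

/-- The word `B e(t₁) B e(t₂) ⋯ e(tₖ) B` for `T = [t₁, …, tₖ]`. -/
def interlace (B : List α) (e : β → List α) (T : List β) : List α :=
  B ++ T.flatMap fun t => e t ++ B

@[simp] theorem interlace_nil (B : List α) (e : β → List α) : interlace B e [] = B := by
  simp [interlace]

theorem interlace_cons (B : List α) (e : β → List α) (t : β) (T : List β) :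
    interlace B e (t :: T) = B ++ (e t ++ interlace B e T) := by
  simp [interlace]

theorem interlace_append_cons (B : List α) (e : β → List α) (S : List β) (t : β) (T : List β) :
    interlace B e (S ++ t :: T) = interlace B e S ++ (e t ++ interlace B e T) := by
  simp [interlace]

theorem length_le_length_interlace (B : List α) (hB : B ≠ []) (e : β → List α) (T : List β) :
    T.length ≤ (interlace B e T).length := by
  have := List.length_pos_iff.2 hB
  induction T with
  | nil => simp
  | cons t T ih => rw [interlace_cons]; simp; omega

theorem exists_interlace_eq_append (B : List α) (e : β → List α) (T : List β) :
    ∃ A, interlace B e T = A ++ B := by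
  induction T with
  | nil => exact ⟨[], by simp⟩
  | cons t T ih =>
    obtain ⟨A, hA⟩ := ih
    exact ⟨B ++ (e t ++ A), by rw [interlace_cons, hA]; simp⟩

/-- The recursion defining `genWord` and the one defining `spacers` correspond under `interlace`;
this is the induction step of `genWord_add`. -/
theorem interlace_flatMap {ι : Type*} (B : List α) (e : β → List α) (S : List β) (c : ι → β)
    (L : List ι) :
    interlace B e ((L.flatMap fun i => S ++ [c i]) ++ S) =
      (L.flatMap fun i => interlace B e S ++ e (c i)) ++ interlace B e S := by
  induction L with
  | nil => simp
  | cons i L ih =>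
    rw [List.flatMap_cons, List.append_assoc, List.append_assoc, List.singleton_append,
      interlace_append_cons, ih]
    simp

/-- The numbers of `1`s between consecutive occurrences of `w n` in `w (n + k)`. -/
def spacers (q : ℕ → ℕ) (a : ℕ → ℕ → ℕ) (n : ℕ) : ℕ → List ℕ
  | 0 => []
  | k + 1 =>
    ((List.range (q (n + k))).flatMap fun i => spacers q a n k ++ [a (n + k) i]) ++
      spacers q a n k

variable (q : ℕ → ℕ) (a : ℕ → ℕ → ℕ)

theorem genWord_add (n k : ℕ) :
    genWord q a (n + k) =
      interlace (genWord q a n) (fun t => List.replicate t 1) (spacers q a n k) := by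
  induction k with
  | zero => simp [spacers]
  | succ k ih => rw [← add_assoc, genWord, spacers, interlace_flatMap, ih]

theorem mem_spacers_iff (n k t : ℕ) :
    t ∈ spacers q a n k ↔ ∃ j < k, ∃ i < q (n + j), t = a (n + j) i := by
  induction k with
  | zero => simp [spacers]
  | succ k ih =>
    simp only [spacers, List.mem_append, List.mem_flatMap, List.mem_range, List.mem_singleton, ih]
    constructor
    · rintro (⟨i, hi, ⟨j, hj, h⟩ | h⟩ | ⟨j, hj, h⟩)
      · exact ⟨j, by omega, h⟩
      · exact ⟨k, by omega, i, hi, h⟩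
      · exact ⟨j, by omega, h⟩
    · rintro ⟨j, hj, i, hi, h⟩
      rcases Nat.lt_succ_iff_lt_or_eq.1 hj with hj | rfl
      · exact Or.inr ⟨j, hj, i, hi, h⟩
      · exact Or.inl ⟨i, hi, Or.inr h⟩

theorem genWord_ne_nil (n : ℕ) : genWord q a n ≠ [] := by
  induction n with
  | zero => simp [genWord]
  | succ n ih => simp [genWord, ih]

theorem genWord_prefix_genWord {n m : ℕ} (h : n ≤ m) : genWord q a n <+: genWord q a m := by
  obtain ⟨k, rfl⟩ := Nat.exists_eq_add_of_le h
  rw [genWord_add, interlace]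
  exact List.prefix_append _ _

theorem genWord_infix_genWord {n m : ℕ} (h : n ≤ m) : genWord q a n <:+: genWord q a m :=
  (genWord_prefix_genWord q a h).isInfix

/-- The word with prescribed numbers of `1`s between its consecutive `0`s. -/
abbrev gapWord (c : List ℕ) : List (Fin 2) := interlace [0] (fun t => List.replicate t 1) c

theorem genWord_eq_gapWord (n : ℕ) : genWord q a n = gapWord (spacers q a 0 n) := by
  simpa [genWord] using genWord_add q a 0 n

theorem gapWord_cons (t : ℕ) (c : List ℕ) :
    gapWord (t :: c) = 0 :: (List.replicate t 1 ++ gapWord c) := interlace_cons _ _ _ _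

theorem gapWord_eq_cons (c : List ℕ) : ∃ A, gapWord c = 0 :: A := ⟨_, rfl⟩

theorem length_gapWord (c : List ℕ) : (gapWord c).length = (c.map (· + 1)).sum + 1 := by
  induction c with
  | nil => simp
  | cons t c ih => rw [gapWord_cons]; simp [ih]; omega

/-- Block structure over `w n` becomes block structure of gap sequences, where a spacer is a single
letter and every block has the same length. -/
theorem gapWord_interlace (c T : List ℕ) :
    gapWord (interlace c (fun t => [t]) T) =
      interlace (gapWord c) (fun t => List.replicate t 1) T := by
  induction T with
  | nil => simp
  | cons t T ih =>
    rw [interlace_cons, interlace_cons, List.singleton_append, gapWord, interlace_append_cons]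
    rw [← ih]

theorem exists_append_of_append_zero_cons_eq {s A B : List (Fin 2)} {y : ℕ}
    (h : s ++ 0 :: A = List.replicate y 1 ++ 0 :: B) :
    ∃ s', s = List.replicate y 1 ++ s' ∧ s' ++ 0 :: A = 0 :: B := by
  induction y generalizing s with
  | zero => exact ⟨s, by simpa using h⟩
  | succ y ih =>
    cases s with
    | nil => simp [List.replicate_succ] at h
    | cons b s =>
      simp only [List.replicate_succ, List.cons_append, List.cons.injEq] at h
      obtain ⟨s', rfl, h'⟩ := ih h.2
      exact ⟨s', by simp [List.replicate_succ, h.1], h'⟩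

theorem replicate_append_zero_cons_inj {A B : List (Fin 2)} {x y : ℕ}
    (h : List.replicate x 1 ++ 0 :: A = List.replicate y 1 ++ 0 :: B) : x = y ∧ A = B := by
  induction x generalizing y with
  | zero => cases y <;> simp_all [List.replicate_succ]
  | succ x ih =>
    cases y with
    | zero => simp [List.replicate_succ] at h
    | succ y => simpa using ih (by simpa [List.replicate_succ] using h)

theorem prefix_of_gapWord_append_eq {c d : List ℕ} {t : List (Fin 2)}
    (h : gapWord c ++ t = gapWord d) : c <+: d := by
  induction c generalizing d with
  | nil => exact List.nil_prefix
  | cons x c ih =>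
    cases d with
    | nil => simp [gapWord_cons, interlace] at h
    | cons y d =>
      simp only [gapWord_cons, List.cons_append, List.cons.injEq, true_and, List.append_assoc] at h
      obtain ⟨A, hA⟩ := gapWord_eq_cons c
      obtain ⟨B, hB⟩ := gapWord_eq_cons d
      obtain ⟨rfl, h'⟩ := replicate_append_zero_cons_inj (A := A ++ t) (B := B) (by
        simpa [hA, hB] using h)
      exact List.cons_prefix_cons.2 ⟨rfl, ih (by simp [hA, hB, h'])⟩

/-- A gap word begins and ends with `0`, so an occurrence cuts no run of `1`s inside its range and
is an occurrence of gap sequences. Each gap `t` skipped accounts for `t + 1` letters of the offset.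
-/
theorem exists_append_of_gapWord_infix {c d : List ℕ} {s t : List (Fin 2)}
    (h : s ++ gapWord c ++ t = gapWord d) :
    ∃ d₁ d₂, d = d₁ ++ c ++ d₂ ∧ s.length = (d₁.map (· + 1)).sum := by
  obtain ⟨A, hA⟩ := gapWord_eq_cons c
  induction d generalizing s with
  | nil =>
    cases s with
    | nil =>
      obtain ⟨d₂, h⟩ := prefix_of_gapWord_append_eq (by rwa [List.nil_append] at h)
      exact ⟨[], d₂, h.symm, rfl⟩
    | cons b s => simp [hA] at h
  | cons y d ih =>
    cases s with
    | nil =>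
      obtain ⟨d₂, h⟩ := prefix_of_gapWord_append_eq (by rwa [List.nil_append] at h)
      exact ⟨[], d₂, h.symm, rfl⟩
    | cons b s =>
      obtain ⟨B, hB⟩ := gapWord_eq_cons d
      rw [gapWord_cons] at h
      simp only [List.cons_append, List.cons.injEq, hA, hB, List.append_assoc] at h
      obtain ⟨s', rfl, h'⟩ := exists_append_of_append_zero_cons_eq h.2
      obtain ⟨d₁, d₂, rfl, h₂⟩ := ih (s := s') (by simp [hA, hB, h'])
      exact ⟨y :: d₁, d₂, by simp, by simp [h₂]; omega⟩

/-- An aligned occurrence is preceded by whole blocks `G t`, each accounting for `|gapWord G| + t`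
letters, a multiple of `r`. A misaligned one would have its two spacers `x` and `y` facing the same
entry of two copies of `G`, forcing `x = y`. -/
theorem dvd_of_interlace_eq {r : ℕ} {G T d₁ d₂ : List ℕ} {x y : ℕ} (hxy : x ≠ y)
    (hr : ∀ t ∈ T, r ∣ (gapWord G).length + t)
    (h : interlace G (fun t => [t]) T = d₁ ++ interlace G (fun t => [t]) [x, y] ++ d₂) :
    r ∣ (d₁.map (· + 1)).sum := by
  rw [length_gapWord] at hr
  induction T generalizing d₁ with
  | nil =>
    have := congrArg List.length h
    simp [interlace_cons] at this
    omega
  | cons t T ih =>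
    by_cases hd : G.length + 1 ≤ d₁.length
    · rw [interlace_cons, ← List.append_assoc, List.append_assoc d₁] at h
      obtain ⟨d₁', rfl⟩ : ∃ d, d₁ = G ++ [t] ++ d := by
        obtain ⟨d, hd⟩ := List.prefix_of_prefix_length_le (List.prefix_append (G ++ [t]) _)
          (h ▸ List.prefix_append d₁ _) (by simpa using hd)
        exact ⟨d, hd.symm⟩
      have h' := ih (d₁ := d₁') (fun t ht => hr t (List.mem_cons_of_mem _ ht)) (by simpa using h)
      have := dvd_add (hr t List.mem_cons_self) h'
      rw [show (((G ++ [t] ++ d₁').map (· + 1)).sum) =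
          (G.map (· + 1)).sum + 1 + t + (d₁'.map (· + 1)).sum by simp; omega]
      exact this
    · rcases Nat.eq_zero_or_pos d₁.length with h0 | h0
      · simp [List.length_eq_zero_iff.1 h0]
      exfalso
      have hl := congrArg List.length h
      obtain _ | ⟨t₂, T⟩ := T
      · simp [interlace_cons] at hl; omega
      obtain _ | ⟨t₃, T⟩ := T
      · simp [interlace_cons] at hl; omega
      simp only [interlace_cons, interlace_nil, List.append_assoc,
        List.cons_append] at h
      -- These positions hold `x` and `y` on the right; on the left both hold `G[j]`, in the second
      -- and third copies of `G`, where `d₁.length = j + 1`.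
      have e₁ := congrArg (fun l => l[d₁.length + G.length]?) h
      have e₂ := congrArg (fun l => l[d₁.length + (G.length + 1 + G.length)]?) h
      beta_reduce at e₁ e₂
      obtain ⟨j, hj⟩ : ∃ j, d₁.length = j + 1 := ⟨d₁.length - 1, by omega⟩
      have hjG : j < G.length := by omega
      simp only [List.getElem?_append, List.getElem?_cons, hj] at e₁ e₂
      grind
end Words

/-! ### Minimality and closed forward-invariant sets. -/

section Systems

variable {X : Type*} [TopologicalSpace X]

/-- A nonempty closed set that is forward invariant under a minimal homeomorphism of a compact
space is the whole space. -/
theorem IsMinimalSystem.eq_univ_of_isClosed [CompactSpace X] {T : X ≃ₜ X}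
    (hT : IsMinimalSystem T) {Y : Set X} (hY : IsClosed Y) (hne : Y.Nonempty)
    (hTY : ∀ x ∈ Y, T x ∈ Y) : Y = Set.univ := by
  obtain ⟨y, hy⟩ := hne
  have hfw : ∀ (n : ℕ) x, x ∈ Y → T^[n] x ∈ Y := fun n x hx => by
    induction n with
    | zero => exact hx
    | succ n ih => rw [Function.iterate_succ_apply']; exact hTY _ ih
  have hcl (n : ℕ) : IsClosed (T.symm^[n] ⁻¹' Y) :=
    hY.preimage (T.symm.continuous.iterate n)
  -- The preimages under `T.symm^[n]` are the images of `Y` under the iterates of `T`. They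
  -- decrease, and a point common to all of them has its whole two-sided orbit in `Y`.
  obtain ⟨x, hx⟩ := IsCompact.nonempty_iInter_of_sequence_nonempty_isCompact_isClosed
    (fun n : ℕ => T.symm^[n] ⁻¹' Y)
    (fun n x hx => by
      have := hTY _ hx
      rwa [Function.iterate_succ_apply', T.apply_symm_apply] at this)
    (fun n => ⟨T^[n] y, by
      have : Function.LeftInverse T.symm^[n] T^[n] :=
        Function.LeftInverse.iterate T.symm_apply_apply n
      simpa [this y] using hy⟩)
    (hcl 0).isCompact hcl
  rw [Set.mem_iInter] at hx
  have hsub : (Set.range fun n : ℤ => (T ^ n) x) ⊆ Y := by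
    rintro _ ⟨n, rfl⟩
    have hco (S : X ≃ₜ X) (n : ℕ) (z : X) : (S ^ n) z = S^[n] z := by
      induction n with
      | zero => rfl
      | succ n ih => rw [pow_succ', Homeomorph.mul_apply, ih, Function.iterate_succ_apply']
    obtain ⟨n, rfl | rfl⟩ := n.eq_nat_or_neg
    · simpa [hco] using hfw n x (hx 0)
    · have hx' := hx n
      have : ((T ^ (-(n : ℤ))) x) = T.symm^[n] x := by
        rw [zpow_neg, zpow_natCast, ← inv_pow, hco]; rfl
      rw [Set.mem_preimage, ← this] at hx'
      exact hx'
  exact Set.eq_univ_of_univ_subset ((hT.2 x).closure_eq ▸ closure_minimal hsub hY)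

/-- A continuous function invariant under a minimal homeomorphism of a compact space is
constant. -/
theorem IsMinimalSystem.eq_of_invariant [CompactSpace X] {T : X ≃ₜ X} (hT : IsMinimalSystem T)
    {Y : Type*} [TopologicalSpace Y] [T1Space Y] {f : X → Y} (hf : Continuous f)
    (hinv : ∀ x, f (T x) = f x) (x y : X) : f x = f y := by
  have := hT.eq_univ_of_isClosed (isClosed_singleton.preimage hf : IsClosed (f ⁻¹' {f y}))
    ⟨y, rfl⟩ (fun z hz => (hinv z).trans hz)
  exact Set.eq_univ_iff_forall.1 this x

end Systems

/-! ### Factors of points, and bounds on the spacers. -/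

section Factors

variable {A : Type*}

theorem length_factor (x : ℤ → A) (k : ℤ) (l : ℕ) : (factor x k l).length = l := by
  simp [factor]

theorem getElem_factor (x : ℤ → A) (k : ℤ) (l i : ℕ) (h : i < (factor x k l).length) :
    (factor x k l)[i] = x (k + i) := by
  simp [factor]

theorem factor_add (x : ℤ → A) (k : ℤ) (l m : ℕ) :
    factor x k (l + m) = factor x k l ++ factor x (k + l) m := by
  simp [factor, List.ofFn_add, add_assoc]

theorem factor_infix_factor (x : ℤ → A) {k k' : ℤ} {l l' : ℕ} (h : k' ≤ k)
    (h' : k + l ≤ k' + l') : factor x k l <:+: factor x k' l' := by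
  obtain ⟨i, rfl⟩ := Int.le.dest h
  obtain ⟨j, rfl⟩ : ∃ j, l' = i + l + j := ⟨l' - (i + l), by omega⟩
  rw [factor_add, factor_add]
  exact List.infix_append _ _ _

theorem factor_congr {x y : ℤ → A} {k k' : ℤ} {l : ℕ} (h : ∀ i < l, x (k + i) = y (k' + i)) :
    factor x k l = factor y k' l :=
  List.ofFn_inj.2 (funext fun i => h i i.2)

theorem isClopen_setOf_factor [TopologicalSpace A] [DiscreteTopology A] (k : ℤ) (l : ℕ)
    (P : List A → Prop) : IsClopen {x : ℤ → A | P (factor x k l)} := by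
  have hc : Continuous fun (x : ℤ → A) (i : Fin l) => x (k + (i : ℕ)) := by fun_prop
  exact (isClopen_discrete {g : Fin l → A | P (List.ofFn g)}).preimage hc

end Factors

variable {q : ℕ → ℕ} {a : ℕ → ℕ → ℕ}

theorem isClosed_ferencziSet : IsClosed (ferencziSet q a) := by
  have : ferencziSet q a =
      ⋂ (k : ℤ) (l : ℕ), {x | ∃ n, factor x k l <:+: genWord q a n} := by
    ext x; simp [ferencziSet]
  rw [this]
  exact isClosed_iInter fun k => isClosed_iInter fun l =>
    (isClopen_setOf_factor k l fun u => ∃ n, u <:+: genWord q a n).1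

instance : CompactSpace (ferencziSet q a) :=
  isCompact_iff_compactSpace.1 isClosed_ferencziSet.isCompact

theorem ferencziShift_apply (x : ferencziSet q a) (j : ℤ) :
    (ferencziShift q a x : ℤ → Fin 2) j = (x : ℤ → Fin 2) (j + 1) := rfl

theorem ferencziShift_iterate (n : ℕ) (x : ferencziSet q a) (j : ℤ) :
    ((ferencziShift q a)^[n] x : ℤ → Fin 2) j = (x : ℤ → Fin 2) (j + n) := by
  induction n generalizing j with
  | zero => simp
  | succ n ih =>
    rw [Function.iterate_succ_apply', ferencziShift_apply, ih]
    push_cast; ring_nf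

theorem ferencziShift_zpow (n : ℤ) (x : ferencziSet q a) (j : ℤ) :
    ((ferencziShift q a ^ n) x : ℤ → Fin 2) j = (x : ℤ → Fin 2) (j + n) := by
  induction n generalizing j with
  | zero => simp
  | succ n ih =>
    rw [add_comm, zpow_one_add, Homeomorph.mul_apply, ferencziShift_apply, ih]
    ring_nf
  | pred n ih =>
    have e : (ferencziShift q a ^ (-n : ℤ)) x
        = ferencziShift q a ((ferencziShift q a ^ (-n - 1 : ℤ)) x) := by
      rw [← Homeomorph.mul_apply, ← zpow_one_add]; congr 2; ring
    have h := ih (j - 1)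
    rw [e, ferencziShift_apply] at h
    rw [sub_add_cancel] at h
    rw [h]; ring_nf

/-- A word with arbitrarily long extensions on both sides inside the generating words
occurs in some point of `X_W`. -/
theorem exists_factor_eq (v : List (Fin 2))
    (h : ∀ l : ℕ, ∃ m s t, genWord q a m = s ++ v ++ t ∧ l ≤ s.length ∧ l ≤ t.length) :
    ∃ x ∈ ferencziSet q a, factor x 0 v.length = v := by
  let F : ℕ → Set (ℤ → Fin 2) := fun l => {x | factor x 0 v.length = v} ∩
    {x | ∃ m, factor x (-l) (l + v.length + l) <:+: genWord q a m}
  have hF (l : ℕ) : IsClosed (F l) :=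
    (isClopen_setOf_factor _ _ (· = v)).1.inter
      (isClopen_setOf_factor _ _ fun u => ∃ n, u <:+: genWord q a n).1
  obtain ⟨x, hx⟩ := IsCompact.nonempty_iInter_of_sequence_nonempty_isCompact_isClosed F
    (fun l x hx => ⟨hx.1, hx.2.imp fun m hm =>
      (factor_infix_factor x (by push_cast; omega) (by push_cast; omega)).trans hm⟩)
    (fun l => by
      obtain ⟨m, s, t, hm, hs, ht⟩ := h l
      -- The default `0` outside the word is harmless: membership in `F l` constrains a bounded
      -- window only.
      let x : ℤ → Fin 2 := fun j => (s ++ v ++ t).getD (j + s.length).toNat 0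
      have h1 : factor x (-s.length) (s.length + v.length + t.length) = s ++ v ++ t := by
        apply List.ext_getElem
        · simp [length_factor]; omega
        · intro i hi hi'
          rw [getElem_factor]
          simp only [x]
          rw [List.getD_eq_getElem?_getD, show (-(s.length : ℤ) + i + s.length).toNat = i by omega,
            List.getElem?_eq_getElem hi', Option.getD_some]
      refine ⟨x, ?_, m, ?_⟩
      · rw [factor_add, factor_add] at h1
        have := List.append_inj_left h1 (by simp [length_factor])
        have := List.append_inj_right this (by simp [length_factor])
        simpa using this
      · rw [hm, ← h1]
        exact factor_infix_factor x (by omega) (by push_cast; omega))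
    (hF 0).isCompact hF
  rw [Set.mem_iInter] at hx
  refine ⟨x, fun k l => ?_, (hx 0).1⟩
  refine (hx (k.natAbs + l)).2.imp fun m hm => (factor_infix_factor x ?_ ?_).trans hm <;>
    grind

/-- Unbounded spacers would put the constant sequence `1`, a fixed point, in `X_W`. -/
theorem exists_spacer_le (haper : IsAperiodicSystem (ferencziShift q a)) :
    ∃ K, ∀ m, ∀ i < q m, a m i ≤ K := by
  by_contra! h
  have hx : (fun _ => 1 : ℤ → Fin 2) ∈ ferencziSet q a := by
    intro k l
    obtain ⟨m, i, hi, hl⟩ := h l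
    refine ⟨m + 1, ?_⟩
    have h1 : factor (fun _ => 1 : ℤ → Fin 2) k l <:+: List.replicate (a m i) 1 := by
      rw [show factor (fun _ => 1 : ℤ → Fin 2) k l = List.replicate l 1 by simp [factor]]
      exact (List.prefix_replicate_iff.2 ⟨by simpa using hl.le, by simp⟩).isInfix
    rw [genWord]
    refine h1.trans ((List.IsInfix.trans ?_ (List.infix_of_mem_flatten (List.mem_map_of_mem
      (List.mem_range.2 hi)))).trans (List.prefix_append _ _).isInfix)
    exact (List.suffix_append _ _).isInfix
  exact haper ⟨_, hx⟩ 1 one_pos rfl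

/-- If `q m = 0` from some level on, the generating words stabilise, and then factors of points have
bounded length. -/
theorem exists_level (hne : (ferencziSet q a).Nonempty) (n : ℕ) : ∃ m ≥ n, 0 < q m := by
  by_contra! h
  obtain ⟨x, hx⟩ := hne
  have hc : ∀ m ≥ n, genWord q a m = genWord q a n := by
    intro m hm
    induction m, hm using Nat.le_induction with
    | base => rfl
    | succ m hm ih => rw [genWord, Nat.le_zero.1 (h m hm), ih]; simp
  obtain ⟨m, hm⟩ := hx 0 ((genWord q a n).length + 1)
  have h1 : genWord q a m <:+: genWord q a n := by
    rcases le_total m n with h | h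
    · exact genWord_infix_genWord q a h
    · rw [hc m h]
  have := (hm.trans h1).length_le
  rw [length_factor] at this
  omega

theorem exists_le_length_spacers (hne : (ferencziSet q a).Nonempty) (n l : ℕ) :
    ∃ k, l ≤ (spacers q a n k).length := by
  have hmono : Monotone fun k => (spacers q a n k).length :=
    monotone_nat_of_le_succ fun k => by simp [spacers]
  induction l with
  | zero => exact ⟨0, Nat.zero_le _⟩
  | succ l ih =>
    obtain ⟨k, hk⟩ := ih
    obtain ⟨m, hm, hq⟩ := exists_level hne (n + k)
    obtain ⟨j, rfl⟩ := Nat.exists_eq_add_of_le (show n ≤ m by omega)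
    refine ⟨j + 1, ?_⟩
    have h1 : (spacers q a n k).length ≤ (spacers q a n j).length := hmono (by omega)
    obtain ⟨p, hp⟩ := Nat.exists_eq_add_of_lt hq
    simp only [spacers, hp, zero_add, List.range_succ_eq_map, List.flatMap_cons,
      List.length_append, List.length_singleton]
    omega

/-- Every factor of a generating word occurs in some point of `X_W`. -/
theorem exists_factor_eq_of_infix (hne : (ferencziSet q a).Nonempty) {v : List (Fin 2)} {n : ℕ}
    (hv : v <:+: genWord q a n) : ∃ x ∈ ferencziSet q a, factor x 0 v.length = v := by
  refine exists_factor_eq v fun l => ?_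
  obtain ⟨s₀, t₀, h₀⟩ := hv
  -- Two consecutive spacers surround the chosen copy of `w n`; `l` more on each side give
  -- extensions of length at least `l`.
  obtain ⟨k, hk⟩ := exists_le_length_spacers hne n (2 * l + 2)
  obtain ⟨T₁, T₂, t, t', hT, h₁, h₂⟩ : ∃ T₁ T₂ t t', spacers q a n k = T₁ ++ t :: t' :: T₂ ∧
      l ≤ T₁.length ∧ l ≤ T₂.length := by
    refine ⟨(spacers q a n k).take l, (spacers q a n k).drop (l + 1 + 1),
      (spacers q a n k)[l], (spacers q a n k)[l + 1], ?_, ?_, ?_⟩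
    · rw [← List.drop_eq_getElem_cons (by omega), ← List.drop_eq_getElem_cons (by omega),
        List.take_append_drop]
    · simp; omega
    · simp; omega
  have hl (T : List ℕ) := length_le_length_interlace (genWord q a n) (genWord_ne_nil q a n)
    (fun t => List.replicate t 1) T
  refine ⟨n + k, interlace (genWord q a n) (fun t => List.replicate t 1) T₁ ++
    (List.replicate t 1 ++ s₀), t₀ ++ (List.replicate t' 1 ++
      interlace (genWord q a n) (fun t => List.replicate t 1) T₂), ?_, ?_, ?_⟩
  · rw [genWord_add, hT, interlace_append_cons, interlace_cons]
    nth_rewrite 2 [← h₀]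
    simp only [List.append_assoc]
  · have := hl T₁; simp; omega
  · have := hl T₂; simp; omega

/-- Beyond every level there are two different spacers. -/
theorem exists_spacer_lt (hne : (ferencziSet q a).Nonempty)
    (haper : IsAperiodicSystem (ferencziShift q a)) (n : ℕ) :
    ∃ m ≥ n, ∃ i < q m, ∃ m' ≥ n, ∃ i' < q m', a m i < a m' i' := by
  by_contra! h
  obtain ⟨m₀, hm₀, hq₀⟩ := exists_level hne n
  have hconst : ∀ m ≥ n, ∀ i < q m, a m i = a m₀ 0 := fun m hm i hi =>
    le_antisymm (h m₀ hm₀ 0 hq₀ m hm i hi) (h m hm i hi m₀ hm₀ 0 hq₀)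
  set u := genWord q a n ++ List.replicate (a m₀ 0) 1 with hu
  -- If all late spacers are equal, one more spacer at the end turns `w m` into an exact power of
  -- `u`. Every point then has period `|u|`, against aperiodicity.
  have hpow : ∀ m ≥ n, ∃ N, genWord q a m ++ List.replicate (a m₀ 0) 1 =
      (List.replicate N u).flatten := by
    intro m hm
    obtain ⟨k, rfl⟩ := Nat.exists_eq_add_of_le hm
    have hT : ∀ t ∈ spacers q a n k, t = a m₀ 0 := fun t ht => by
      obtain ⟨j, -, i, hi, rfl⟩ := (mem_spacers_iff q a n k t).1 ht
      exact hconst _ (by omega) i hi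
    refine ⟨(spacers q a n k).length + 1, ?_⟩
    rw [genWord_add, List.eq_replicate_of_mem hT]
    rw [List.length_replicate]
    generalize (spacers q a n k).length = N
    induction N with
    | zero => simp [hu]
    | succ N ih =>
      rw [List.replicate_succ (a := a m₀ 0), interlace_cons, List.replicate_succ (a := u) (n := N + 1),
        List.flatten_cons]
      rw [← ih, hu]
      simp
  have hperiod : ∀ (N i : ℕ) (_ : i + u.length < ((List.replicate N u).flatten).length),
      ((List.replicate N u).flatten)[i + u.length]? = ((List.replicate N u).flatten)[i]? := by
    intro N i hi
    have hcomm : (List.replicate N u).flatten ++ u = u ++ (List.replicate N u).flatten := by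
      rw [← List.flatten_cons, ← List.replicate_succ, List.replicate_succ']; simp
    have h1 : ((List.replicate N u).flatten ++ u)[i + u.length]? =
      ((List.replicate N u).flatten)[i]? := by
      rw [hcomm, List.getElem?_append_right (by omega), Nat.add_sub_cancel]
    rwa [List.getElem?_append_left hi] at h1
  obtain ⟨x, hx⟩ := hne
  have hu0 : 0 < u.length := by
    have := List.length_pos_iff.2 (genWord_ne_nil q a n)
    simp [hu]; omega
  refine haper ⟨x, hx⟩ u.length hu0 (Subtype.ext (funext fun j => ?_))
  rw [ferencziShift_iterate]
  obtain ⟨m, hm⟩ := hx j (u.length + 1)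
  obtain ⟨N, hN⟩ := hpow (max m n) (le_max_right _ _)
  have hm' : factor x j (u.length + 1) <:+: (List.replicate N u).flatten := by
    rw [← hN]
    exact (hm.trans (genWord_infix_genWord q a (le_max_left _ _))).trans
      (List.prefix_append _ _).isInfix
  obtain ⟨s, t, hst⟩ := hm'
  have hlen := congrArg List.length hst
  simp only [List.length_append, length_factor] at hlen
  have h1 := hperiod N s.length (by omega)
  have hget : ∀ i < u.length + 1, (List.replicate N u).flatten[s.length + i]? = some (x (j + i)) := by
    intro i hi
    rw [← hst, List.append_assoc, List.getElem?_append_right (by omega),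
      List.getElem?_append_left (by rw [length_factor]; omega), Nat.add_sub_cancel_left,
      List.getElem?_eq_getElem (by rw [length_factor]; omega), getElem_factor]
  rw [hget _ (by omega)] at h1
  have h2 := hget 0 (by omega)
  rw [add_zero, ← h1] at h2
  simpa using h2

/-! ### Approximate return times. -/

section Returns

/-- A continuous function on `X_W` is determined up to `ε` by finitely many coordinates. -/
theorem exists_forall_dist_lt {Z : Type*} [PseudoMetricSpace Z] {f : ferencziSet q a → Z}
    (hf : Continuous f) {ε : ℝ} (hε : 0 < ε) :
    ∃ l : ℕ, ∀ x y : ferencziSet q a,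
      (∀ j : ℤ, j.natAbs ≤ l → (x : ℤ → Fin 2) j = (y : ℤ → Fin 2) j) →
        dist (f x) (f y) < ε := by
  by_contra! h
  let F : ℕ → Set (ferencziSet q a × ferencziSet q a) := fun l =>
    (⋂ j : ℤ, ⋂ (_ : j.natAbs ≤ l), {p | (p.1 : ℤ → Fin 2) j = (p.2 : ℤ → Fin 2) j}) ∩
      {p | ε ≤ dist (f p.1) (f p.2)}
  have hF (l : ℕ) : IsClosed (F l) := by
    refine IsClosed.inter (isClosed_iInter fun j => isClosed_iInter fun _ => ?_) ?_
    · exact isClosed_eq ((continuous_apply j).comp (continuous_subtype_val.comp continuous_fst))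
        ((continuous_apply j).comp (continuous_subtype_val.comp continuous_snd))
    · exact isClosed_le continuous_const
        ((hf.comp continuous_fst).dist (hf.comp continuous_snd))
  obtain ⟨p, hp⟩ := IsCompact.nonempty_iInter_of_sequence_nonempty_isCompact_isClosed F
    (fun l p hp => ⟨Set.mem_iInter₂.2 fun j hj => Set.mem_iInter₂.1 hp.1 j (by omega), hp.2⟩)
    (fun l => by
      obtain ⟨x, y, hxy, hd⟩ := h l
      exact ⟨(x, y), Set.mem_iInter₂.2 hxy, hd⟩)
    (hF 0).isCompact hF
  rw [Set.mem_iInter] at hp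
  have hxy : p.1 = p.2 :=
    Subtype.ext (funext fun j => Set.mem_iInter₂.1 (hp j.natAbs).1 j le_rfl)
  have := (hp 0).2
  rw [Set.mem_ofPred_eq, hxy, dist_self] at this
  exact absurd hε this.not_gt

/-- For `n` large, `|w n| + a m i` is an approximate return time of a continuous function. -/
theorem exists_forall_dist_iterate_lt (hne : (ferencziSet q a).Nonempty)
    {Z : Type*} [PseudoMetricSpace Z]
    {f : ferencziSet q a → Z} (hf : Continuous f) {ε : ℝ} (hε : 0 < ε) :
    ∃ n, ∀ m ≥ n, ∀ i < q m, ∃ x,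
      dist (f x) (f ((ferencziShift q a)^[(genWord q a n).length + a m i] x)) < ε := by
  obtain ⟨l, hl⟩ := exists_forall_dist_lt hf hε
  obtain ⟨n, hn⟩ := exists_le_length_spacers hne 0 (2 * l + 1)
  have hlen : 2 * l + 1 ≤ (genWord q a n).length := by
    rw [genWord_eq_gapWord]
    exact hn.trans (length_le_length_interlace _ (by simp) _ _)
  refine ⟨n, fun m hm i hi => ?_⟩
  set w := genWord q a n with hw
  have hv : w ++ List.replicate (a m i) 1 ++ w <:+: genWord q a (m + 1) := by
    obtain ⟨j, rfl⟩ := Nat.exists_eq_add_of_le hm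
    have hmem : a (n + j) i ∈ spacers q a n (j + 1) :=
      (mem_spacers_iff q a n (j + 1) _).2 ⟨j, by omega, i, hi, rfl⟩
    obtain ⟨S, T, hST⟩ := List.append_of_mem hmem
    rw [add_assoc, genWord_add, hST, interlace_append_cons]
    obtain ⟨A, hA⟩ := exists_interlace_eq_append w (fun t => List.replicate t 1) S
    rw [← hw, hA, interlace]
    exact ⟨A, T.flatMap fun t => List.replicate t 1 ++ w, by simp⟩
  obtain ⟨x, hx, hxv⟩ := exists_factor_eq_of_infix hne hv
  -- Shifting by `l` centres the window of radius `l` inside the first copy of `w`, as `|w| ≥ 2 * l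
  -- + 1`. The second copy starts `|w| + a m i` places later, so the two windows agree.
  refine ⟨(ferencziShift q a)^[l] ⟨x, hx⟩, hl _ _ fun j hj => ?_⟩
  rw [← Function.iterate_add_apply, ferencziShift_iterate, ferencziShift_iterate]
  rw [List.length_append, factor_add, List.length_append] at hxv
  have h2 := List.append_inj_right hxv (by simp [length_factor])
  have h1 := List.append_inj_left hxv (by simp [length_factor])
  rw [factor_add] at h1
  have h1 := List.append_inj_left h1 (by simp [length_factor])
  obtain ⟨c, hc⟩ : ∃ c : ℕ, j + l = c := ⟨(j + l).toNat, by omega⟩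
  have e := (List.ofFn_inj.1 (h1.trans h2.symm))
  have e := congrFun e ⟨c, by omega⟩
  simp only [List.length_replicate, zero_add] at e
  change x (j + l) = x (j + _)
  rw [hc, e]
  congr 1
  push_cast
  omega

end Returns

/-! ### From approximate periods to exact ones. -/

section Rational

/-- Approximate periods at the lengths `|w n| + a m i` give an exact period dividing all of
these from some level on. -/
theorem exists_period_dvd (hne : (ferencziSet q a).Nonempty)
    (haper : IsAperiodicSystem (ferencziShift q a)) (h : ℕ → ℝ)
    (hadd : ∀ k l, h (k + l) ≤ h k + h l) (hsub : ∀ k l, h l ≤ h k + h (k + l))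
    (hε : ∀ ε > 0, ∃ n, ∀ m ≥ n, ∀ i < q m, h ((genWord q a n).length + a m i) ≤ ε) :
    ∃ k > 0, h k = 0 ∧ ∃ n, ∀ m ≥ n, ∀ i < q m, k ∣ (genWord q a n).length + a m i := by
  classical
  have h0 : 0 ≤ h 0 := by have := hsub 0 0; simp at this; linarith
  have hnn : ∀ k, 0 ≤ h k := fun k => by have := hsub k 0; simp at this; linarith
  have hmin : ∀ s : Finset ℕ, (∀ t ∈ s, 0 < h t) → ∃ ε > 0, ∀ t ∈ s, ε < h t := by
    intro s hs
    rcases s.eq_empty_or_nonempty with rfl | hne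
    · exact ⟨1, one_pos, by simp⟩
    · obtain ⟨t, ht, hmin⟩ := s.exists_min_image h hne
      exact ⟨h t / 2, half_pos (hs t ht), fun t' ht' => by
        have := hs t ht; have := hmin t' ht'; linarith⟩
  obtain ⟨K, hK⟩ := exists_spacer_le haper
  have hex : ∃ k, 0 < k ∧ h k = 0 := by
    by_contra! hcon
    -- Differences of distinct spacers lie in this finite set. Without an exact period `h` would
    -- stay above `ε` there, while two return times with `h ≤ ε / 2` give a difference with `h ≤ ε`.
    obtain ⟨ε, hε0, hs⟩ := hmin (Finset.Icc 1 K) fun t ht =>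
      lt_of_le_of_ne (hnn t) (hcon t (Finset.mem_Icc.1 ht).1).symm
    obtain ⟨n, hn⟩ := hε (ε / 2) (half_pos hε0)
    obtain ⟨m, hm, i, hi, m', hm', i', hi', hlt⟩ := exists_spacer_lt hne haper n
    have h1 := hn m hm i hi
    have h2 := hn m' hm' i' hi'
    have h3 := hsub ((genWord q a n).length + a m i) (a m' i' - a m i)
    rw [show (genWord q a n).length + a m i + (a m' i' - a m i) =
      (genWord q a n).length + a m' i' by omega] at h3
    have h4 := hs (a m' i' - a m i) (Finset.mem_Icc.2 ⟨by omega, by have := hK m' i' hi'; omega⟩)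
    linarith
  obtain ⟨hk, hk0⟩ := Nat.find_spec hex
  have hlt : ∀ t, 0 < t → t < Nat.find hex → h t ≠ 0 := fun t ht htk ht0 =>
    Nat.find_min hex htk ⟨ht, ht0⟩
  generalize Nat.find hex = k at hk hk0 hlt
  refine ⟨k, hk, hk0, ?_⟩
  -- As `h` vanishes on multiples of the least period `k`, a return time with `h ≤ ε` has a
  -- remainder modulo `k` with `h ≤ ε`; by the choice of `ε` that remainder is zero.
  obtain ⟨ε, hε0, hs⟩ := hmin (Finset.Ico 1 k) fun t ht =>
    lt_of_le_of_ne (hnn t) (hlt t (Finset.mem_Ico.1 ht).1 (Finset.mem_Ico.1 ht).2).symm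
  have hmul : ∀ s, h (k * s) ≤ 0 := fun s => by
    induction s with
    | zero => have := hsub k 0; simp [hk0] at this; simpa using this
    | succ s ih => have := hadd (k * s) k; rw [mul_add_one]; linarith
  refine (hε ε hε0).imp fun n hn m hm i hi => ?_
  have h1 := hn m hm i hi
  generalize (genWord q a n).length + a m i = N at h1
  by_contra hd
  have h2 := hsub (k * (N / k)) (N % k)
  rw [Nat.div_add_mod] at h2
  have h3 := hs (N % k) (Finset.mem_Ico.2
    ⟨Nat.pos_of_ne_zero fun h => hd (Nat.dvd_of_mod_eq_zero h), Nat.mod_lt _ hk⟩)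
  have := hmul (N / k)
  linarith

/-- The modulus of an eigenfunction is constant and positive and its eigenvalue is unimodular. -/
theorem IsContinuousEigenfunction.norm_eq {X : Type*} [TopologicalSpace X] [CompactSpace X]
    {T : X ≃ₜ X} (hT : IsMinimalSystem T) {c : ℂ} {f : X → ℂ}
    (hf : IsContinuousEigenfunction T c f) : ‖c‖ = 1 ∧ ∃ M > 0, ∀ x, ‖f x‖ = M := by
  obtain ⟨hc, hf0, hfT⟩ := hf
  have := hT.1
  obtain ⟨y, hy⟩ := Function.ne_iff.1 hf0
  obtain ⟨x, -, hx⟩ := isCompact_univ.exists_isMaxOn Set.univ_nonempty hc.norm.continuousOn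
  have hx : ∀ z, ‖f z‖ ≤ ‖f x‖ := fun z => hx (Set.mem_univ z)
  have hpos : 0 < ‖f x‖ := (norm_pos_iff.2 hy).trans_le (hx y)
  have h1 : ‖c‖ ≤ 1 := by
    have := hx (T x)
    rw [hfT, norm_mul] at this
    exact le_of_mul_le_mul_right (by linarith) hpos
  have h2 : 1 ≤ ‖c‖ := by
    have h := hfT (T.symm x)
    rw [T.apply_symm_apply] at h
    have h' := congrArg norm h
    rw [norm_mul] at h'
    have := mul_le_mul_of_nonneg_left (hx (T.symm x)) (norm_nonneg c)
    exact le_of_mul_le_mul_right (by linarith) hpos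
  have h3 := le_antisymm h1 h2
  exact ⟨h3, ‖f x‖, hpos, fun z => hT.eq_of_invariant hc.norm
    (fun w => by rw [hfT, norm_mul, h3, one_mul]) z x⟩

theorem IsContinuousEigenvalue.exists_pow_eq_one (hmin : IsMinimalSystem (ferencziShift q a))
    (haper : IsAperiodicSystem (ferencziShift q a)) {c : ℂ}
    (hc : IsContinuousEigenvalue (ferencziShift q a) c) :
    ∃ k > 0, c ^ k = 1 ∧ ∃ n, ∀ m ≥ n, ∀ i < q m, k ∣ (genWord q a n).length + a m i := by
  obtain ⟨f, hf⟩ := hc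
  obtain ⟨hc1, M, hM, hfM⟩ := hf.norm_eq hmin
  obtain ⟨hfc, -, hfT⟩ := hf
  have hne : (ferencziSet q a).Nonempty := Set.nonempty_coe_sort.1 hmin.1
  have hpow (k : ℕ) : ‖c ^ k‖ = 1 := by rw [norm_pow, hc1, one_pow]
  have hit (k : ℕ) (x) : f ((ferencziShift q a)^[k] x) = c ^ k * f x := by
    induction k with
    | zero => simp
    | succ k ih => rw [Function.iterate_succ_apply', hfT, ih, pow_succ']; ring
  obtain ⟨k, hk, hk0, hd⟩ := exists_period_dvd hne haper (fun k => ‖c ^ k - 1‖)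
    (fun k l => by
      have : c ^ (k + l) - 1 = c ^ k * (c ^ l - 1) + (c ^ k - 1) := by ring
      rw [this]
      refine (norm_add_le _ _).trans ?_
      rw [norm_mul, hpow, one_mul, add_comm])
    (fun k l => by
      have : ‖c ^ l - 1‖ = ‖(c ^ (k + l) - 1) - (c ^ k - 1)‖ := by
        rw [show (c ^ (k + l) - 1) - (c ^ k - 1) = c ^ k * (c ^ l - 1) by ring, norm_mul, hpow,
          one_mul]
      rw [this, add_comm ‖c ^ k - 1‖]
      exact norm_sub_le (c ^ (k + l) - 1) (c ^ k - 1))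
    (fun ε hε => by
      -- The tolerance is `ε * M` because `f` has constant modulus `M`, so moving by `N` steps
      -- changes `f` by `‖c ^ N - 1‖ * M`.
      obtain ⟨n, hn⟩ := exists_forall_dist_iterate_lt hne hfc (mul_pos hε hM)
      refine ⟨n, fun m hm i hi => ?_⟩
      obtain ⟨x, hx⟩ := hn m hm i hi
      rw [hit, dist_comm, dist_eq_norm, ← sub_one_mul, norm_mul, hfM] at hx
      exact (lt_of_mul_lt_mul_right hx hM.le).le)
  exact ⟨k, hk, by rwa [norm_eq_zero, sub_eq_zero] at hk0, hd⟩

end Rational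

/-! ### Cyclic factors from recognizable words. -/

section Cyclic

theorem exists_adjacent_spacers_ne (hne : (ferencziSet q a).Nonempty)
    (haper : IsAperiodicSystem (ferencziShift q a)) (n : ℕ) :
    ∃ k S₁ x y S₂, x ≠ y ∧ spacers q a n k = S₁ ++ x :: y :: S₂ := by
  obtain ⟨m, hm, i, hi, m', hm', i', hi', hlt⟩ := exists_spacer_lt hne haper n
  obtain ⟨j, rfl⟩ := Nat.exists_eq_add_of_le hm
  obtain ⟨j', rfl⟩ := Nat.exists_eq_add_of_le hm'
  have h1 := (mem_spacers_iff q a n (max j j' + 1) _).2 ⟨j, by omega, i, hi, rfl⟩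
  have h2 := (mem_spacers_iff q a n (max j j' + 1) _).2 ⟨j', by omega, i', hi', rfl⟩
  refine ⟨max j j' + 1, ?_⟩
  by_contra! hcon
  have hch : (spacers q a n (max j j' + 1)).IsChain (· = ·) :=
    List.isChain_iff_forall_rel_of_append_cons_cons.2 fun {x y S₁ S₂} h => by
      by_contra hxy
      exact hcon S₁ x y S₂ hxy h
  have hp := List.isChain_iff_pairwise.1 hch
  exact hlt.ne (hp.forall_of_forall (fun _ _ => rfl) h1 h2)

/-- Since `w m` is a prefix of `w (max n m)`, the offset can be computed in a word that decomposes
over `w n`. -/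
theorem dvd_length_of_append_eq {r n m x y : ℕ} {s t : List (Fin 2)}
    (hr : ∀ m ≥ n, ∀ i < q m, r ∣ (genWord q a n).length + a m i) (hxy : x ≠ y)
    (h : s ++ interlace (genWord q a n) (fun t => List.replicate t 1) [x, y] ++ t =
      genWord q a m) : r ∣ s.length := by
  obtain ⟨t', ht'⟩ := genWord_prefix_genWord q a (le_max_right n m)
  obtain ⟨k, hk⟩ := Nat.exists_eq_add_of_le (le_max_left n m)
  rw [← h, hk, genWord_add, genWord_eq_gapWord q a n, ← gapWord_interlace, ← gapWord_interlace,
    List.append_assoc] at ht'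
  obtain ⟨d₁, d₂, hd, hs⟩ := exists_append_of_gapWord_infix ht'
  rw [hs]
  refine dvd_of_interlace_eq hxy (fun t ht => ?_) hd
  obtain ⟨j, -, i, hi, rfl⟩ := (mem_spacers_iff q a n k t).1 ht
  rw [← genWord_eq_gapWord]
  exact hr _ (by omega) i hi

/-- If `r` divides all `|w n| + a m i` from some level on, then the rotation on `r` points is a
factor of the Ferenczi subshift. -/
theorem isTopologicalFactor_cyclicSystem (hmin : IsMinimalSystem (ferencziShift q a))
    (haper : IsAperiodicSystem (ferencziShift q a)) {r n : ℕ} (hr0 : 0 < r)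
    (hr : ∀ m ≥ n, ∀ i < q m, r ∣ (genWord q a n).length + a m i) :
    IsTopologicalFactor (ferencziShift q a) (cyclicSystem r) := by
  have hne : (ferencziSet q a).Nonempty := Set.nonempty_coe_sort.1 hmin.1
  obtain ⟨k, S₁, x, y, S₂, hxy, hS⟩ := exists_adjacent_spacers_ne hne haper n
  set v := interlace (genWord q a n) (fun t => List.replicate t 1) [x, y] with hv
  have hvw : v <:+: genWord q a (n + k) := by
    obtain ⟨A, hA⟩ :=
      exists_interlace_eq_append (genWord q a n) (fun t => List.replicate t 1) S₁
    rw [genWord_add, hS, interlace_append_cons, interlace_cons, hA, interlace, hv]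
    exact ⟨A, S₂.flatMap fun t => List.replicate t 1 ++ genWord q a n, by
      simp [interlace_cons]⟩
  have hopen (k : ℤ) : IsOpen {z : ferencziSet q a | factor (z : ℤ → Fin 2) k v.length = v} :=
    (isClopen_setOf_factor k v.length (· = v)).2.preimage continuous_subtype_val
  have hoccurs : ∀ z : ferencziSet q a, ∃ k : ℤ, factor (z : ℤ → Fin 2) k v.length = v := by
    intro z
    obtain ⟨z₀, hz₀, hzv⟩ := exists_factor_eq_of_infix hne hvw
    obtain ⟨_, hz, j, rfl⟩ := (hmin.2 z).inter_open_nonempty _ (hopen 0) ⟨⟨z₀, hz₀⟩, hzv⟩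
    have hz : factor ((ferencziShift q a ^ j) z : ℤ → Fin 2) 0 v.length = v := hz
    exact ⟨j, (factor_congr fun i _ => by rw [ferencziShift_zpow]; ring_nf).trans hz⟩
  have hle : ∀ (z : ferencziSet q a) (k : ℤ) (d : ℕ), factor (z : ℤ → Fin 2) k v.length = v →
      factor (z : ℤ → Fin 2) (k + d) v.length = v → r ∣ d := by
    intro z k d h1 h2
    -- Both occurrences of `v` lie in one generating word; their offsets there are multiples of `r`,
    -- hence so is their distance.
    obtain ⟨m, s, t, hm⟩ := z.2 k (d + v.length)
    have e1 := dvd_length_of_append_eq (s := s ++ factor (z : ℤ → Fin 2) k d) (t := t) hr hxy (by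
      rw [← hm, factor_add, h2]; simp [hv])
    rw [add_comm, factor_add, h1] at hm
    have e2 := dvd_length_of_append_eq (s := s)
      (t := factor (z : ℤ → Fin 2) (k + v.length) d ++ t) hr hxy (by
      rw [← hm]; simp [hv])
    rw [List.length_append, length_factor] at e1
    exact (Nat.dvd_add_right e2).1 e1
  have hcast : ∀ (z : ferencziSet q a) (k l : ℤ), factor (z : ℤ → Fin 2) k v.length = v →
      factor (z : ℤ → Fin 2) l v.length = v → (k : ZMod r) = l := by
    intro z k l h1 h2
    rcases le_total k l with h | h
    · obtain ⟨d, rfl⟩ := Int.le.dest h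
      simp [(ZMod.natCast_eq_zero_iff d r).2 (hle z k d h1 h2)]
    · obtain ⟨d, rfl⟩ := Int.le.dest h
      simp [(ZMod.natCast_eq_zero_iff d r).2 (hle z l d h2 h1)]
  choose κ hκ using hoccurs
  have hshift : ∀ z, -(κ (ferencziShift q a z) : ZMod r) = -(κ z : ZMod r) + 1 := by
    intro z
    rw [hcast (ferencziShift q a z) _ (κ z - 1) (hκ _) (by
      exact (factor_congr fun i _ => by rw [ferencziShift_apply]; ring_nf).trans (hκ z))]
    push_cast; ring
  -- The sign is needed because the shift moves an occurrence one place to the left. The choice of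
  -- `κ` is irrelevant modulo `r`, which gives local constancy.
  refine ⟨fun z => -(κ z : ZMod r), ?_, ?_, hshift⟩
  · refine (IsLocallyConstant.iff_eventually_eq _).2 (fun z => ?_) |>.continuous
    filter_upwards [(hopen (κ z)).mem_nhds (hκ z)] with z' hz'
    rw [hcast z' _ _ (hκ z') hz']
  · intro c
    obtain ⟨z⟩ := hmin.1
    have : NeZero r := ⟨hr0.ne'⟩
    refine ⟨(ferencziShift q a)^[(c + κ z).val] z, ?_⟩
    have hit : ∀ n : ℕ, -(κ ((ferencziShift q a)^[n] z) : ZMod r) = -(κ z : ZMod r) + n := by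
      intro n
      induction n with
      | zero => simp
      | succ n ih => rw [Function.iterate_succ_apply', hshift, ih]; push_cast; ring
    change -(κ _ : ZMod r) = c
    rw [hit, ZMod.natCast_zmod_val]; ring

end Cyclic

/-! ### Eigenvalues, the largest modulus and equicontinuous factors. -/

theorem isEquicontinuousSystem_of_discrete {X : Type*} [TopologicalSpace X] [DiscreteTopology X]
    (T : X ≃ₜ X) : IsEquicontinuousSystem T := by
  intro U hU
  refine ⟨Set.diagonal X, (isOpen_discrete _).mem_nhdsSet.2 subset_rfl, ?_⟩
  rintro ⟨x, y⟩ hxy n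
  obtain rfl : x = y := hxy
  exact subset_of_mem_nhdsSet hU rfl

theorem IsTopologicalFactor.isContinuousEigenvalue {X : Type*} [TopologicalSpace X] [Nonempty X]
    {T : X ≃ₜ X} {r : ℕ} (hr : 0 < r) (h : IsTopologicalFactor T (cyclicSystem r)) {c : ℂ}
    (hc : c ^ r = 1) : IsContinuousEigenvalue T c := by
  obtain ⟨π, hπ, -, hT⟩ := h
  have : NeZero r := ⟨hr.ne'⟩
  have hc0 : c ≠ 0 := by rintro rfl; simp [hr.ne'] at hc
  refine ⟨fun x => c ^ (π x).val, ?_, ?_, fun x => ?_⟩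
  · exact (continuous_of_discreteTopology (f := fun z : ZMod r => c ^ z.val)).comp hπ
  · obtain ⟨x⟩ := ‹Nonempty X›
    exact fun h => pow_ne_zero _ hc0 (congrFun h x)
  · have h1 : ((π x).val + 1 : ℕ) = cyclicSystem r (π x) := by
      rw [Nat.cast_add, ZMod.natCast_zmod_val]; simp [cyclicSystem]
    simp only
    rw [hT, ← h1, ZMod.val_natCast, ← pow_succ', ← Nat.div_add_mod ((π x).val + 1) r, pow_add,
      pow_mul, hc, one_pow, one_mul]
    simp

theorem exp_pow_eq_one_iff (p : ℤ) {r : ℕ} (hr : 0 < r) (hp : IsCoprime p (r : ℤ)) (k : ℕ) :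
    Complex.exp (2 * (Real.pi : ℂ) * Complex.I * ((p : ℂ) / (r : ℂ))) ^ k = 1 ↔ r ∣ k := by
  have hr' : (r : ℂ) ≠ 0 := Nat.cast_ne_zero.2 hr.ne'
  rw [← Complex.exp_nat_mul, Complex.exp_eq_one_iff]
  have h2 := Complex.two_pi_I_ne_zero
  have : ∀ n : ℤ, (k : ℂ) * (2 * (Real.pi : ℂ) * Complex.I * ((p : ℂ) / (r : ℂ))) =
      n * (2 * Real.pi * Complex.I) ↔ (k : ℤ) * p = n * r := by
    intro n
    rw [show (k : ℂ) * (2 * (Real.pi : ℂ) * Complex.I * ((p : ℂ) / (r : ℂ))) =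
      (k * p / r) * (2 * Real.pi * Complex.I) by ring, mul_left_inj' h2, div_eq_iff hr']
    exact_mod_cast Iff.rfl
  simp only [this]
  constructor
  · rintro ⟨n, hn⟩
    have : (r : ℤ) ∣ k * p := ⟨n, by rw [hn]; ring⟩
    exact Int.natCast_dvd_natCast.1 (hp.symm.dvd_of_dvd_mul_right this)
  · rintro ⟨c, rfl⟩
    exact ⟨c * p, by push_cast; ring⟩

/-- `w (n' + 1)` is a run of blocks `w n' 1^(a n' i)`, of lengths divisible by `r`, followed by `w
n'`. Raising the level lets moduli found at different levels be combined. -/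
theorem dvd_length_genWord_succ {r n : ℕ}
    (hr : ∀ m ≥ n, ∀ i < q m, r ∣ (genWord q a n).length + a m i) {n' : ℕ} (hn : n ≤ n') :
    ∀ m ≥ n', ∀ i < q m, r ∣ (genWord q a n').length + a m i := by
  induction n', hn using Nat.le_induction with
  | base => exact hr
  | succ n' hn ih =>
    intro m hm i hi
    have hsum : ∀ L : List ℕ, (∀ j ∈ L, j < q n') →
        r ∣ (L.flatMap fun i => genWord q a n' ++ List.replicate (a n' i) 1).length := by
      intro L hL
      induction L with
      | nil => simp
      | cons j L ihL =>
        rw [List.flatMap_cons, List.length_append]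
        refine dvd_add ?_ (ihL fun j hj => hL j (List.mem_cons_of_mem _ hj))
        simpa using ih n' le_rfl j (hL j List.mem_cons_self)
    rw [genWord, List.length_append, add_assoc]
    exact dvd_add (hsum _ fun j hj => List.mem_range.1 hj) (ih m (by omega) i hi)

/-- The moduli dividing all `|w n| + a m i` from some level on are the divisors of the
largest one. -/
theorem exists_max_modulus (hne : (ferencziSet q a).Nonempty)
    (haper : IsAperiodicSystem (ferencziShift q a)) :
    ∃ R > 0, (∃ n, ∀ m ≥ n, ∀ i < q m, R ∣ (genWord q a n).length + a m i) ∧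
      ∀ r, (∃ n, ∀ m ≥ n, ∀ i < q m, r ∣ (genWord q a n).length + a m i) → r ∣ R := by
  obtain ⟨K, hK⟩ := exists_spacer_le haper
  let P : ℕ → Prop := fun r => ∃ n, ∀ m ≥ n, ∀ i < q m, r ∣ (genWord q a n).length + a m i
  have hle : ∀ r, P r → 0 < r ∧ r ≤ K := by
    rintro r ⟨n, hn⟩
    obtain ⟨m, hm, i, hi, m', hm', i', hi', hlt⟩ := exists_spacer_lt hne haper n
    -- Divisibility of a nonzero difference of spacers gives both `0 < r` and `r ≤ K`.
    have h1 : r ∣ a m' i' - a m i := by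
      have := Nat.dvd_sub (hn m' hm' i' hi') (hn m hm i hi)
      rwa [Nat.add_sub_add_left] at this
    have h2 := hK m' i' hi'
    exact ⟨Nat.pos_of_dvd_of_pos h1 (by omega), (Nat.le_of_dvd (by omega) h1).trans (by omega)⟩
  have hP1 : P 1 := ⟨0, fun _ _ _ _ => one_dvd _⟩
  classical
  have hR : P (Nat.findGreatest P K) := Nat.findGreatest_spec (hle 1 hP1).2 hP1
  refine ⟨_, (hle _ hR).1, hR, fun r hr => ?_⟩
  -- The lcm with the greatest modulus is again a modulus, so it equals that modulus.
  have hlcm : P (Nat.lcm r (Nat.findGreatest P K)) := by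
    obtain ⟨n, hn⟩ := hr
    obtain ⟨n', hn'⟩ := hR
    exact ⟨max n n', fun m hm i hi => Nat.lcm_dvd
      (dvd_length_genWord_succ hn (le_max_left _ _) m hm i hi)
      (dvd_length_genWord_succ hn' (le_max_right _ _) m hm i hi)⟩
  have h1 := Nat.le_findGreatest (hle _ hlcm).2 hlcm
  have h2 := le_antisymm h1 (Nat.le_of_dvd (hle _ hlcm).1 (Nat.dvd_lcm_right _ _))
  exact h2 ▸ Nat.dvd_lcm_left r _

/-- An equicontinuous factor of the Ferenczi subshift is periodic, with a period dividing all
`|w n| + a m i` from some level on. -/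
theorem exists_iterate_eq_id (hmin : IsMinimalSystem (ferencziShift q a))
    (haper : IsAperiodicSystem (ferencziShift q a)) {Z : Type*} [MetricSpace Z] [CompactSpace Z]
    {P : Z ≃ₜ Z} {φ : ferencziSet q a → Z} (hP : IsEquicontinuousSystem P)
    (hφ : IsFactorMap (ferencziShift q a) P φ) :
    ∃ k > 0, P^[k] = id ∧ ∃ n, ∀ m ≥ n, ∀ i < q m, k ∣ (genWord q a n).length + a m i := by
  obtain ⟨hc, hsurj, hT⟩ := hφ
  have hne : (ferencziSet q a).Nonempty := Set.nonempty_coe_sort.1 hmin.1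
  have hsemi (k : ℕ) (x) : φ ((ferencziShift q a)^[k] x) = P^[k] (φ x) :=
    Function.Semiconj.iterate_right (f := φ) hT k x
  let I : ℕ → C(Z, Z) := fun k => ⟨P^[k], P.continuous.iterate k⟩
  have hIadd (k l : ℕ) (z : Z) : I (k + l) z = I l (I k z) := by
    change P^[k + l] z = P^[l] (P^[k] z)
    rw [add_comm, Function.iterate_add_apply]
  have hI0 (z : Z) : I 0 z = z := rfl
  obtain ⟨k, hk, hk0, hd⟩ := exists_period_dvd hne haper (fun k => dist (I k) (I 0))
    (fun k l => (ContinuousMap.dist_le (by positivity)).2 fun z => by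
      rw [hIadd]
      have h1 := ContinuousMap.dist_apply_le_dist (f := I l) (g := I 0) (I k z)
      have h2 := ContinuousMap.dist_apply_le_dist (f := I k) (g := I 0) z
      rw [hI0] at h1 h2 ⊢
      have := dist_triangle (I l (I k z)) (I k z) z
      linarith)
    (fun k l => (ContinuousMap.dist_le (by positivity)).2 fun z => by
      obtain ⟨z, rfl⟩ := P.surjective.iterate k z
      have h1 := ContinuousMap.dist_apply_le_dist (f := I (k + l)) (g := I 0) z
      have h2 := ContinuousMap.dist_apply_le_dist (f := I k) (g := I 0) z
      rw [hIadd] at h1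
      have := dist_triangle_right (I l (I k z)) (I k z) z
      change dist (I l (I k z)) (I k z) ≤ _
      rw [hI0] at h1 h2
      linarith)
    (fun ε hε => by
      obtain ⟨δ, hδ, hPδ⟩ := (isEquicontinuousSystem_iff P).1 hP ε hε
      obtain ⟨n, hn⟩ := exists_forall_dist_iterate_lt hne hc hδ
      refine ⟨n, fun m hm i hi => (ContinuousMap.dist_le hε.le).2 fun z => ?_⟩
      obtain ⟨x, hx⟩ := hn m hm i hi
      generalize (genWord q a n).length + a m i = N at hx
      rw [hsemi] at hx
      -- Asking for the estimate along all iterates `j` makes the set forward invariant.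
      -- Equicontinuity puts `x` in it, and minimality spreads the bound to every point of `Z`.
      have hY : IsClosed {y | ∀ j, dist (P^[j] (φ y)) (P^[j] (P^[N] (φ y))) ≤ ε} := by
        simp only [Set.ofPred_forall]
        exact isClosed_iInter fun j => isClosed_le (((P.continuous.iterate j).comp hc).dist
          ((P.continuous.iterate j).comp ((P.continuous.iterate N).comp hc))) continuous_const
      have huniv := hmin.eq_univ_of_isClosed hY ⟨x, fun j => (hPδ _ _ hx j).le⟩ (fun y hy j => by
        have := hy (j + 1)
        rwa [Function.iterate_succ_apply, Function.iterate_succ_apply, ← hT,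
          (Function.Commute.self_iterate P N).eq, ← hT] at this)
      obtain ⟨y, rfl⟩ := hsurj z
      have := Set.eq_univ_iff_forall.1 huniv y 0
      rw [dist_comm]
      exact this)
  refine ⟨k, hk, funext fun z => ?_, hd⟩
  exact DFunLike.congr_fun (dist_eq_zero.1 hk0) z

end Ferenczi

open Ferenczi in
theorem mainTheorem9 (q : ℕ → ℕ) (a : ℕ → ℕ → ℕ)
    (hmin : Ferenczi.IsMinimalSystem (Ferenczi.ferencziShift q a))
    (haper : Ferenczi.IsAperiodicSystem (Ferenczi.ferencziShift q a)) :
    (∀ α : ℝ, Irrational α →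
      ¬ Ferenczi.IsContinuousEigenvalue (Ferenczi.ferencziShift q a)
        (Complex.exp (2 * (Real.pi : ℂ) * Complex.I * (α : ℂ)))) ∧
    (∀ (p : ℤ) (r : ℕ), 0 < r → IsCoprime p (r : ℤ) →
      (Ferenczi.IsContinuousEigenvalue (Ferenczi.ferencziShift q a)
          (Complex.exp (2 * (Real.pi : ℂ) * Complex.I * ((p : ℂ) / (r : ℂ)))) ↔
        ∃ n : ℕ, ∀ m ≥ n, ∀ i < q m, r ∣ (Ferenczi.genWord q a n).length + a m i)) ∧
    (Ferenczi.IsTopologicallyWeaklyMixing (Ferenczi.ferencziShift q a) ↔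
      ∀ r : ℕ, 1 < r → ∀ n : ℕ, ∃ m ≥ n, ∃ i < q m,
        ¬ r ∣ (Ferenczi.genWord q a n).length + a m i) ∧
    (∃ rmax : ℕ,
      IsGreatest {r : ℕ | 0 < r ∧
        Ferenczi.IsTopologicalFactor (Ferenczi.ferencziShift q a) (Ferenczi.cyclicSystem r)}
        rmax ∧
      Ferenczi.IsMaximalEquicontinuousFactor.{u} (Ferenczi.ferencziShift q a)
        (Ferenczi.cyclicSystem rmax)) := by
  have hne : (ferencziSet q a).Nonempty := Set.nonempty_coe_sort.1 hmin.1
  have := hmin.1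
  have h2 : ∀ (p : ℤ) (r : ℕ), 0 < r → IsCoprime p (r : ℤ) →
      (IsContinuousEigenvalue (ferencziShift q a)
          (Complex.exp (2 * (Real.pi : ℂ) * Complex.I * ((p : ℂ) / (r : ℂ)))) ↔
        ∃ n : ℕ, ∀ m ≥ n, ∀ i < q m, r ∣ (genWord q a n).length + a m i) := by
    intro p r hr hp
    constructor
    · intro h
      obtain ⟨k, -, hk1, n, hn⟩ := h.exists_pow_eq_one hmin haper
      exact ⟨n, fun m hm i hi => ((exp_pow_eq_one_iff p hr hp k).1 hk1).trans (hn m hm i hi)⟩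
    · rintro ⟨n, hn⟩
      exact (isTopologicalFactor_cyclicSystem hmin haper hr hn).isContinuousEigenvalue hr
        ((exp_pow_eq_one_iff p hr hp r).2 dvd_rfl)
  refine ⟨fun α hα h => ?_, h2, ⟨fun h r hr n => ?_, fun h c f hf => ?_⟩, ?_⟩
  · obtain ⟨k, hk, hk1, -⟩ := h.exists_pow_eq_one hmin haper
    rw [← Complex.exp_nat_mul, Complex.exp_eq_one_iff] at hk1
    obtain ⟨n, hn⟩ := hk1
    rw [show (k : ℂ) * (2 * (Real.pi : ℂ) * Complex.I * (α : ℂ)) =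
      (k * α) * (2 * Real.pi * Complex.I) by ring,
      mul_left_inj' Complex.two_pi_I_ne_zero] at hn
    have hn' : (k : ℝ) * α = n := by exact_mod_cast hn
    exact (hα.natCast_mul hk.ne').ne_int n hn'
  · by_contra! hcon
    have hr0 : 0 < r := by omega
    obtain ⟨f, hf⟩ := (h2 1 r hr0 isCoprime_one_left).2 ⟨n, hcon⟩
    have hinv := h _ f hf
    obtain ⟨x, hx⟩ := Function.ne_iff.1 hf.2.1
    have hT := hf.2.2 x
    rw [hinv _ x, eq_comm, mul_eq_right₀ hx, ← pow_one (Complex.exp _),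
      exp_pow_eq_one_iff 1 hr0 isCoprime_one_left] at hT
    have := Nat.le_of_dvd one_pos hT
    omega
  · obtain ⟨k, hk, hk1, n, hn⟩ :=
      IsContinuousEigenvalue.exists_pow_eq_one hmin haper ⟨f, hf⟩
    obtain rfl : k = 1 := by
      by_contra hk'
      obtain ⟨m, hm, i, hi, hd⟩ := h k (by omega) n
      exact hd (hn m hm i hi)
    rw [pow_one] at hk1
    exact hmin.eq_of_invariant hf.1 fun x => by rw [hf.2.2, hk1, one_mul]
  · obtain ⟨R, hR0, ⟨n, hn⟩, hR⟩ := exists_max_modulus hne haper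
    have hfac := isTopologicalFactor_cyclicSystem hmin haper hR0 hn
    refine ⟨R, ⟨⟨hR0, hfac⟩, ?_⟩, isEquicontinuousSystem_of_discrete _, ?_⟩
    · rintro r ⟨hr0, hr⟩
      refine Nat.le_of_dvd hR0 (hR r ((h2 1 r hr0 isCoprime_one_left).1 ?_))
      exact hr.isContinuousEigenvalue hr0
        ((exp_pow_eq_one_iff 1 hr0 isCoprime_one_left r).2 dvd_rfl)
    · obtain ⟨π, hπ⟩ := hfac
      refine ⟨π, hπ, fun Z _ _ P φ hP hφ => ?_⟩
      obtain ⟨k, -, hk1, hkd⟩ := exists_iterate_eq_id hmin haper hP hφ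
      have hPR : P^[R] = id := by
        obtain ⟨d, hd⟩ := hR k hkd
        rw [hd, Function.iterate_mul, hk1, Function.iterate_id]
      have : NeZero R := ⟨hR0.ne'⟩
      obtain ⟨x₀, hx₀⟩ := hπ.2.1 0
      -- With `π x₀ = 0`, this is the only possible value. It is equivariant across the wrap-around
      -- at `R` because `P^[R] = id`, and `ψ ∘ π = φ` spreads from `x₀` by minimality.
      let ψ : ZMod R → Z := fun c => P^[c.val] (φ x₀)
      have hψ1 : ∀ c, ψ (cyclicSystem R c) = P (ψ c) := by
        intro c
        have h1 : (c.val + 1 : ℕ) = cyclicSystem R c := by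
          rw [Nat.cast_add, ZMod.natCast_zmod_val]; simp [cyclicSystem]
        change P^[_] _ = P (P^[_] _)
        rw [← h1, ZMod.val_natCast, ← Function.iterate_succ_apply' P]
        conv_rhs => rw [Nat.succ_eq_add_one, ← Nat.mod_add_div (c.val + 1) R, Function.iterate_add,
          Function.iterate_mul, hPR, Function.iterate_id]
        rfl
      have hψc : Continuous ψ := continuous_of_discreteTopology
      have hψ : ψ ∘ π = φ := by
        have hcl : IsClosed {x | ψ (π x) = φ x} := isClosed_eq (hψc.comp hπ.1) hφ.1
        have huniv := hmin.eq_univ_of_isClosed hcl ⟨x₀, by simp [hx₀, ψ]⟩ fun x hx => by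
          rw [Set.mem_ofPred_eq] at hx ⊢
          rw [hπ.2.2, hψ1, hx, hφ.2.2]
        exact funext fun x => Set.eq_univ_iff_forall.1 huniv x
      refine ⟨ψ, ⟨⟨hψc, ?_, hψ1⟩, hψ⟩, ?_⟩
      · exact Function.Surjective.of_comp (g := π) (hψ ▸ hφ.2.1)
      · rintro ψ' ⟨-, hψ'⟩
        exact hπ.2.1.injective_comp_right (hψ'.trans hψ.symm)
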